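/- Let $P\subset\mathbb{R}^d$ be a polytope (the convex hull of a finite set) and let $c\in\mathbb{R}^d$ be generic, i.e. $\langle c, v-u\rangle\neq 0$ for every edge $uv$ of $P$. Let $v_1,\dots,v_n$ be the vertices of $P$, without repetition, numbered so that $q_i:=\langle v_i,c\rangle$ satisfies $q_1\le\dots\le q_n$. Put $Q=\{\langle x,c\rangle : x\in P\}$ and let $$M_c(P)=\Bigl\{\int_Q\gamma(t)\,\mathrm{d}t \;:\; \gamma:Q\to P \text{ measurable},\ \langle\gamma(t),c\rangle=t \text{ for all } t\in Q\Bigr\}$$ be the monotone path polytope of $(P,c)$. Then $M_c(P)$ is a polytope, and it is normally equivalent to the Minkowski sum of sections $$\sum_{i=2}^{n-1}\{x\in P : \langle x,c\rangle=q_i\},$$ that is, this sum is also a polytope, and the two polytopes have the same normal fan in $\mathbb{R}^d$ (the collection of outer normal cones of the nonempty faces). An empty Minkowski sum is $\{0\}$. -/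

import Mathlib

open scoped Pointwise

/-- A polytope: the convex hull of a finite set of points. -/
def IsPolytope {d : ℕ} (P : Set (EuclideanSpace ℝ (Fin d))) : Prop :=
  ∃ s : Set (EuclideanSpace ℝ (Fin d)), s.Finite ∧ P = convexHull ℝ s

/-- The segment `[u, v]` is an edge of `P`: a one-dimensional (exposed) face. -/
def IsEdge {d : ℕ} (P : Set (EuclideanSpace ℝ (Fin d)))
    (u v : EuclideanSpace ℝ (Fin d)) : Prop :=
  u ≠ v ∧ (segment ℝ u v) ⊆ P ∧ IsExposed ℝ P (segment ℝ u v)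

/-- The direction `c` is generic for `P`: it is not orthogonal to any edge of `P`. -/
def IsGenericDirection {d : ℕ} (P : Set (EuclideanSpace ℝ (Fin d)))
    (c : EuclideanSpace ℝ (Fin d)) : Prop :=
  ∀ u v : EuclideanSpace ℝ (Fin d), IsEdge P u v → inner ℝ c (v - u) ≠ 0

/-- The section of `P` at level `t`: the points `x` of `P` with `⟨x, c⟩ = t`. -/
def levelSection {d : ℕ} (P : Set (EuclideanSpace ℝ (Fin d)))
    (c : EuclideanSpace ℝ (Fin d)) (t : ℝ) : Set (EuclideanSpace ℝ (Fin d)) :=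
  {x | x ∈ P ∧ inner ℝ x c = t}

/-- The image of `P` under the projection `x ↦ ⟨x, c⟩`. -/
def projImage {d : ℕ} (P : Set (EuclideanSpace ℝ (Fin d)))
    (c : EuclideanSpace ℝ (Fin d)) : Set ℝ :=
  (fun x => inner ℝ x c) '' P

/-- `γ` is a (measurable) section over the image of `P` of the projection `x ↦ ⟨x, c⟩` of `P`.
The values of `γ` outside the image play no role. -/
def IsProjSection {d : ℕ} (P : Set (EuclideanSpace ℝ (Fin d)))
    (c : EuclideanSpace ℝ (Fin d)) (γ : ℝ → EuclideanSpace ℝ (Fin d)) : Prop :=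
  Measurable γ ∧ ∀ t ∈ projImage P c, γ t ∈ P ∧ inner ℝ (γ t) c = t

/-- The monotone path polytope of `(P, c)`: the set of the integrals of all sections of the
projection `x ↦ ⟨x, c⟩`. (Sections of a bounded `P` are bounded, hence integrable.) -/
noncomputable def monotonePathPolytope {d : ℕ} (P : Set (EuclideanSpace ℝ (Fin d)))
    (c : EuclideanSpace ℝ (Fin d)) : Set (EuclideanSpace ℝ (Fin d)) :=
  {y | ∃ γ : ℝ → EuclideanSpace ℝ (Fin d),
    IsProjSection P c γ ∧ y = ∫ t in projImage P c, γ t}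

/-- The outer normal cone of `P` at `F`: the vectors `w` for which every point of `F` maximizes
`⟨w, ·⟩` over `P`. -/
def normalCone {d : ℕ} (P F : Set (EuclideanSpace ℝ (Fin d))) :
    Set (EuclideanSpace ℝ (Fin d)) :=
  {w | ∀ x ∈ F, ∀ y ∈ P, inner ℝ w y ≤ inner ℝ w x}

/-- The normal fan of `P`: the collection of the normal cones at the nonempty faces of `P`. -/
def normalFan {d : ℕ} (P : Set (EuclideanSpace ℝ (Fin d))) :
    Set (Set (EuclideanSpace ℝ (Fin d))) :=
  {C | ∃ F : Set (EuclideanSpace ℝ (Fin d)),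
    F ⊆ P ∧ F.Nonempty ∧ IsExposed ℝ P F ∧ C = normalCone P F}

/-- Two polytopes are normally equivalent if they have the same normal fan. -/
def NormallyEquivalent {d : ℕ} (P R : Set (EuclideanSpace ℝ (Fin d))) : Prop :=
  IsPolytope P ∧ IsPolytope R ∧ normalFan P = normalFan R

/-! Between consecutive vertex levels the sections of `P` interpolate linearly
(`exists_eq_interpolation`). Integrating over `Q` therefore turns `M_c(P)` into a Minkowski sum of
the sections at the distinct vertex levels, each dilated by the integral of a hat function
(`monotonePathPolytope_eq_sum`); these weights are positive (`integral_hat_pos`).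

The normal fan of a nonempty compact set depends only on the relation `maxFace P w₀ ⊆ maxFace P w`
(`normalFan_eq_range`). For a Minkowski sum this relation is the conjunction of those of the
summands (`maxFace_sum_subset_iff`), and a positive dilation preserves it, so neither the weights
nor repeated levels matter. A level attained by no index in `2, …, n - 1` is extreme and carries a
single vertex; its section is a point and imposes no condition.

Genericity enters only through `q 1 < q n`: a polytope with two points has an edge
(`IsPolytope.exists_isEdge`), and the ends of that edge lie at different levels. -/

/-- The point at level `t` of the line through `u` and `w` (`u` itself when that line is level). -/
noncomputable def levelPoint {d : ℕ} (c : EuclideanSpace ℝ (Fin d)) (t : ℝ)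
    (u w : EuclideanSpace ℝ (Fin d)) : EuclideanSpace ℝ (Fin d) :=
  AffineMap.lineMap u w ((t - inner ℝ u c) / (inner ℝ w c - inner ℝ u c))

/-- The points at level `t` of the segments that join two points of `s`. -/
def levelPoints {d : ℕ} (s : Set (EuclideanSpace ℝ (Fin d))) (c : EuclideanSpace ℝ (Fin d))
    (t : ℝ) : Set (EuclideanSpace ℝ (Fin d)) :=
  {z | ∃ u ∈ s, ∃ w ∈ s, inner ℝ u c ≤ t ∧ t ≤ inner ℝ w c ∧ z = levelPoint c t u w}

/-! ### Sections of a convex hull -/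

section Sections

variable {d : ℕ} {P s : Set (EuclideanSpace ℝ (Fin d))} {c : EuclideanSpace ℝ (Fin d)} {t : ℝ}

theorem finite_levelPoints (hs : s.Finite) : (levelPoints s c t).Finite := by
  refine ((hs.prod hs).image fun p => levelPoint c t p.1 p.2).subset ?_
  rintro z ⟨u, hu, w, hw, -, -, rfl⟩
  exact ⟨(u, w), ⟨hu, hw⟩, rfl⟩

theorem convex_setOf_inner_lt (c : EuclideanSpace ℝ (Fin d)) (t : ℝ) :
    Convex ℝ {x : EuclideanSpace ℝ (Fin d) | inner ℝ x c < t} :=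
  convex_halfSpace_lt ⟨fun x y => inner_add_left x y c, fun a x => real_inner_smul_left x c a⟩ t

theorem convex_setOf_inner_le (c : EuclideanSpace ℝ (Fin d)) (t : ℝ) :
    Convex ℝ {x : EuclideanSpace ℝ (Fin d) | inner ℝ x c ≤ t} :=
  convex_halfSpace_le ⟨fun x y => inner_add_left x y c, fun a x => real_inner_smul_left x c a⟩ t

theorem convex_setOf_le_inner (c : EuclideanSpace ℝ (Fin d)) (t : ℝ) :
    Convex ℝ {x : EuclideanSpace ℝ (Fin d) | t ≤ inner ℝ x c} :=
  convex_halfSpace_ge ⟨fun x y => inner_add_left x y c, fun a x => real_inner_smul_left x c a⟩ t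

theorem convex_levelSection (hP : Convex ℝ P) : Convex ℝ (levelSection P c t) :=
  hP.inter (convex_hyperplane
    ⟨fun x y => inner_add_left x y c, fun a x => real_inner_smul_left x c a⟩ t)

theorem levelPoint_mem_segment {u w : EuclideanSpace ℝ (Fin d)} (hu : inner ℝ u c ≤ t)
    (hw : t ≤ inner ℝ w c) : levelPoint c t u w ∈ segment ℝ u w := by
  rw [segment_eq_image_lineMap]
  refine ⟨_, ⟨div_nonneg (by linarith) (by linarith), ?_⟩, rfl⟩
  exact div_le_one_of_le₀ (by linarith) (by linarith)

theorem inner_levelPoint {u w : EuclideanSpace ℝ (Fin d)} (hu : inner ℝ u c ≤ t)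
    (hw : t ≤ inner ℝ w c) : inner ℝ (levelPoint c t u w) c = t := by
  rw [levelPoint, AffineMap.lineMap_apply_module, inner_add_left, real_inner_smul_left,
    real_inner_smul_left]
  rcases eq_or_ne (inner ℝ w c - inner ℝ u c) 0 with h | h
  · rw [h]
    simp
    linarith
  · field_simp
    ring

theorem levelPoint_mem_levelSection {u w : EuclideanSpace ℝ (Fin d)} (hu : u ∈ s) (hw : w ∈ s)
    (hut : inner ℝ u c ≤ t) (hwt : t ≤ inner ℝ w c) :
    levelPoint c t u w ∈ levelSection (convexHull ℝ s) c t :=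
  ⟨segment_subset_convexHull hu hw (levelPoint_mem_segment hut hwt), inner_levelPoint hut hwt⟩

theorem mem_levelPoints_self {u : EuclideanSpace ℝ (Fin d)} (hu : u ∈ s) (ht : inner ℝ u c = t) :
    u ∈ levelPoints s c t :=
  ⟨u, hu, u, hu, ht.le, ht.ge, by simp [levelPoint]⟩

/-- The level is supporting, so a combination with positive weights reaches it only if both of its
terms do. -/
theorem mem_convexHull_levelPoints_of_forall_le (hs : ∀ u ∈ s, t ≤ inner ℝ u c)
    {x : EuclideanSpace ℝ (Fin d)} (hx : x ∈ convexHull ℝ s) (hxt : inner ℝ x c = t) :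
    x ∈ convexHull ℝ (levelPoints s c t) := by
  suffices h : convexHull ℝ s ⊆ {x | t ≤ inner ℝ x c ∧
      (inner ℝ x c = t → x ∈ convexHull ℝ (levelPoints s c t))} from (h hx).2 hxt
  refine convexHull_min (fun u hu => ⟨hs u hu, fun h =>
    subset_convexHull ℝ _ (mem_levelPoints_self hu h)⟩) ?_
  rw [convex_iff_forall_pos]
  rintro x ⟨hx, hx'⟩ y ⟨hy, hy'⟩ a b ha hb hab
  have h1 := mul_le_mul_of_nonneg_left hx ha.le
  have h2 := mul_le_mul_of_nonneg_left hy hb.le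
  have h3 : t = a * t + b * t := by rw [← add_mul, hab, one_mul]
  simp only [Set.mem_ofPred_eq, inner_add_left, real_inner_smul_left]
  refine ⟨by linarith, fun h => ?_⟩
  refine convex_convexHull ℝ _ (hx' ?_) (hy' ?_) ha.le hb.le hab
  · exact (mul_left_cancel₀ ha.ne' (by linarith))
  · exact (mul_left_cancel₀ hb.ne' (by linarith))

/-- The point at level `t` of the segment from `p` to `r`, with its denominator cleared, is affine
in `p` and in `r` separately. As `m • K + n • K = (m + n) • K` for convex `K` and nonnegative `m`,
`n`, membership passes from `A` and `B` to their hulls, one variable at a time. -/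
theorem levelCombination_mem {K : Set (EuclideanSpace ℝ (Fin d))} (hK : Convex ℝ K)
    {A B : Set (EuclideanSpace ℝ (Fin d))} (hA : ∀ u ∈ A, inner ℝ u c < t)
    (hB : ∀ w ∈ B, t ≤ inner ℝ w c)
    (h : ∀ u ∈ A, ∀ w ∈ B, (inner ℝ w c - t) • u + (t - inner ℝ u c) • w ∈
      (inner ℝ w c - inner ℝ u c) • K)
    {p r : EuclideanSpace ℝ (Fin d)} (hp : p ∈ convexHull ℝ A) (hr : r ∈ convexHull ℝ B) :
    (inner ℝ r c - t) • p + (t - inner ℝ p c) • r ∈ (inner ℝ r c - inner ℝ p c) • K := by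
  have combine : ∀ {a b m n : ℝ} {x y : EuclideanSpace ℝ (Fin d)}, 0 ≤ a → 0 ≤ b → 0 ≤ m →
      0 ≤ n → x ∈ m • K → y ∈ n • K → a • x + b • y ∈ (a * m + b * n) • K := by
    intro a b m n x y ha hb hm hn hx hy
    rw [hK.add_smul (mul_nonneg ha hm) (mul_nonneg hb hn), mul_smul, mul_smul]
    exact Set.add_mem_add (Set.smul_mem_smul_set hx) (Set.smul_mem_smul_set hy)
  have first : ∀ w ∈ B, ∀ p ∈ convexHull ℝ A,
      (inner ℝ w c - t) • p + (t - inner ℝ p c) • w ∈ (inner ℝ w c - inner ℝ p c) • K := by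
    intro w hw
    suffices hsub : convexHull ℝ A ⊆ {p | inner ℝ p c < t ∧
        (inner ℝ w c - t) • p + (t - inner ℝ p c) • w ∈ (inner ℝ w c - inner ℝ p c) • K} from
      fun p hp => (hsub hp).2
    refine convexHull_min (fun u hu => ⟨hA u hu, h u hu w hw⟩) ?_
    rintro x ⟨hx, hx'⟩ y ⟨hy, hy'⟩ a b ha hb hab
    refine ⟨convex_setOf_inner_lt c t hx hy ha hb hab, ?_⟩
    have hwB := hB w hw
    have := combine ha hb (by linarith) (by linarith) hx' hy'
    obtain rfl : b = 1 - a := by linarith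
    convert this using 1
    · simp only [inner_add_left, real_inner_smul_left]
      congr 1
      ring
    · simp only [inner_add_left, real_inner_smul_left]
      module
  have hpt : inner ℝ p c < t := convexHull_min hA (convex_setOf_inner_lt c t) hp
  suffices hsub : convexHull ℝ B ⊆ {r | t ≤ inner ℝ r c ∧
      (inner ℝ r c - t) • p + (t - inner ℝ p c) • r ∈ (inner ℝ r c - inner ℝ p c) • K} from
    (hsub hr).2
  refine convexHull_min (fun w hw => ⟨hB w hw, first w hw p hp⟩) ?_
  rintro x ⟨hx, hx'⟩ y ⟨hy, hy'⟩ a b ha hb hab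
  refine ⟨convex_setOf_le_inner c t hx hy ha hb hab, ?_⟩
  have := combine ha hb (by linarith) (by linarith) hx' hy'
  obtain rfl : b = 1 - a := by linarith
  convert this using 1
  · simp only [inner_add_left, real_inner_smul_left]
    congr 1
    ring
  · simp only [inner_add_left, real_inner_smul_left]
    module

/-- A section of a convex hull is the convex hull of the points where it meets segments. -/
theorem levelSection_convexHull (s : Set (EuclideanSpace ℝ (Fin d)))
    (c : EuclideanSpace ℝ (Fin d)) (t : ℝ) :
    levelSection (convexHull ℝ s) c t = convexHull ℝ (levelPoints s c t) := by
  refine Set.Subset.antisymm ?_ (convexHull_min ?_ (convex_levelSection (convex_convexHull ℝ s)))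
  · rintro x ⟨hx, hxt⟩
    set A := {u ∈ s | inner ℝ u c < t} with hA
    set B := {u ∈ s | t ≤ inner ℝ u c} with hB
    have hAB : s = A ∪ B := by
      ext u
      simp only [hA, hB, Set.mem_union, Set.mem_sep_iff, ← and_or_left, lt_or_ge, and_true]
    rcases A.eq_empty_or_nonempty with hA0 | hA0
    · refine mem_convexHull_levelPoints_of_forall_le (fun u hu => ?_) hx hxt
      by_contra! hlt
      exact Set.notMem_empty u (hA0 ▸ ⟨hu, hlt⟩)
    rcases B.eq_empty_or_nonempty with hB0 | hB0
    · rw [hAB, hB0, Set.union_empty] at hx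
      exact absurd hxt (convexHull_min (fun u hu => hu.2) (convex_setOf_inner_lt c t) hx).ne
    rw [hAB, convexHull_union hA0 hB0, mem_convexJoin] at hx
    obtain ⟨p, hp, r, hr, a, b, ha, hb, hab, rfl⟩ := hx
    have hpt : inner ℝ p c < t :=
      convexHull_min (fun u hu => hu.2) (convex_setOf_inner_lt c t) hp
    have hrt : t ≤ inner ℝ r c :=
      convexHull_min (fun u hu => hu.2) (convex_setOf_le_inner c t) hr
    have key := levelCombination_mem (convex_convexHull ℝ (levelPoints s c t))
      (A := A) (B := B) (c := c) (t := t) (fun u hu => hu.2) (fun u hu => hu.2) ?_ hp hr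
    · have hpos : inner ℝ r c - inner ℝ p c ≠ 0 := by linarith
      rw [Set.mem_smul_set_iff_inv_smul_mem₀ hpos] at key
      convert key using 1
      simp only [inner_add_left, real_inner_smul_left] at hxt
      rw [eq_inv_smul_iff₀ hpos]
      obtain rfl : b = 1 - a := by linarith
      rw [← hxt]
      module
    · rintro u ⟨hu, hut⟩ w ⟨hw, hwt⟩
      have hpos : inner ℝ w c - inner ℝ u c ≠ 0 := by linarith
      refine ⟨levelPoint c t u w, subset_convexHull ℝ _ ⟨u, hu, w, hw, hut.le, hwt, rfl⟩, ?_⟩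
      rw [levelPoint, AffineMap.lineMap_apply_module]
      match_scalars
      · field_simp
        ring
      · field_simp
  · rintro z ⟨u, hu, w, hw, hut, hwt, rfl⟩
    exact levelPoint_mem_levelSection hu hw hut hwt

/-- Between two levels with no point of `s` strictly between them, the sections of the convex hull
of `s` interpolate linearly. -/
theorem exists_eq_interpolation {a b : ℝ} (hab : a < b)
    (hgap : ∀ u ∈ s, inner ℝ u c ≤ a ∨ b ≤ inner ℝ u c)
    (ha : (levelSection (convexHull ℝ s) c a).Nonempty)
    (hb : (levelSection (convexHull ℝ s) c b).Nonempty) (hat : a ≤ t) (htb : t ≤ b)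
    {x : EuclideanSpace ℝ (Fin d)} (hx : x ∈ levelSection (convexHull ℝ s) c t) :
    ∃ y ∈ levelSection (convexHull ℝ s) c a, ∃ z ∈ levelSection (convexHull ℝ s) c b,
      x = ((b - t) / (b - a)) • y + ((t - a) / (b - a)) • z := by
  have hba : b - a ≠ 0 := by linarith
  rcases hat.eq_or_lt with rfl | hat
  · obtain ⟨z, hz⟩ := hb
    exact ⟨x, hx, z, hz, by simp [hba]⟩
  rcases htb.eq_or_lt with rfl | htb
  · obtain ⟨y, hy⟩ := ha
    exact ⟨y, hy, x, hx, by simp [hba]⟩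
  have hconv : ∀ r, Convex ℝ (levelSection (convexHull ℝ s) c r) :=
    fun r => convex_levelSection (convex_convexHull ℝ s)
  have hsub : convexHull ℝ (levelPoints s c t) ⊆
      ((b - t) / (b - a)) • levelSection (convexHull ℝ s) c a +
        ((t - a) / (b - a)) • levelSection (convexHull ℝ s) c b := by
    refine convexHull_min ?_ (((hconv a).smul _).add ((hconv b).smul _))
    -- With no point of `s` strictly between the levels, a segment crossing level `t` also crosses
    -- `a` and `b`, and its three crossing points are collinear.
    rintro z ⟨u, hu, w, hw, hut, hwt, rfl⟩
    have hua : inner ℝ u c ≤ a := (hgap u hu).resolve_right (by linarith)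
    have hwb : b ≤ inner ℝ w c := (hgap w hw).resolve_left (by linarith)
    have hwu : inner ℝ w c - inner ℝ u c ≠ 0 := by linarith
    refine ⟨_, Set.smul_mem_smul_set
      (levelPoint_mem_levelSection hu hw hua (by linarith)), _, Set.smul_mem_smul_set
      (levelPoint_mem_levelSection hu hw (by linarith) hwb), ?_⟩
    simp only [levelPoint, AffineMap.lineMap_apply_module]
    match_scalars
    · field_simp
      ring
    · field_simp
      ring
  rw [levelSection_convexHull] at hx
  obtain ⟨_, ⟨y, hy, rfl⟩, _, ⟨z, hz, rfl⟩, h⟩ := hsub hx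
  exact ⟨y, hy, z, hz, h.symm⟩

end Sections

/-! ### Closure properties of polytopes -/

section Polytopes

variable {d : ℕ} {P R : Set (EuclideanSpace ℝ (Fin d))}

theorem IsPolytope.convex (hP : IsPolytope P) : Convex ℝ P := by
  obtain ⟨s, -, rfl⟩ := hP
  exact convex_convexHull ℝ s

theorem IsPolytope.isCompact (hP : IsPolytope P) : IsCompact P := by
  obtain ⟨s, hs, rfl⟩ := hP
  exact hs.isCompact_convexHull ℝ

theorem IsPolytope.levelSection (hP : IsPolytope P) (c : EuclideanSpace ℝ (Fin d)) (t : ℝ) :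
    IsPolytope (levelSection P c t) := by
  obtain ⟨s, hs, rfl⟩ := hP
  exact ⟨_, finite_levelPoints hs, levelSection_convexHull s c t⟩

theorem IsPolytope.add (hP : IsPolytope P) (hR : IsPolytope R) : IsPolytope (P + R) := by
  obtain ⟨s, hs, rfl⟩ := hP
  obtain ⟨r, hr, rfl⟩ := hR
  exact ⟨s + r, hs.add hr, (convexHull_add s r).symm⟩

theorem IsPolytope.smul (hP : IsPolytope P) (a : ℝ) : IsPolytope (a • P) := by
  obtain ⟨s, hs, rfl⟩ := hP
  exact ⟨a • s, hs.smul_set, (convexHull_smul a s).symm⟩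

theorem isPolytope_zero : IsPolytope (0 : Set (EuclideanSpace ℝ (Fin d))) :=
  ⟨0, Set.finite_zero, by rw [← Set.singleton_zero, convexHull_singleton]⟩

theorem IsPolytope.sum {ι : Type*} {I : Finset ι} {A : ι → Set (EuclideanSpace ℝ (Fin d))}
    (hA : ∀ i ∈ I, IsPolytope (A i)) : IsPolytope (∑ i ∈ I, A i) :=
  Finset.sum_induction A IsPolytope (fun _ _ => IsPolytope.add) isPolytope_zero hA

theorem IsPolytope.finite_extremePoints (hP : IsPolytope P) : (P.extremePoints ℝ).Finite := by
  obtain ⟨s, hs, rfl⟩ := hP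
  exact hs.subset extremePoints_convexHull_subset

theorem IsPolytope.convexHull_extremePoints (hP : IsPolytope P) :
    convexHull ℝ (P.extremePoints ℝ) = P := by
  exact (hP.finite_extremePoints.isCompact_convexHull ℝ).isClosed.closure_eq.symm.trans
    (closure_convexHull_extremePoints hP.isCompact hP.convex)

end Polytopes

/-! ### Hat functions on a finite set of levels -/

/-- The piecewise linear function that is `1` at `l` and vanishes at the other points of `L`. -/
noncomputable def hat (L : Finset ℝ) (l t : ℝ) : ℝ :=
  if h : (L.erase l).Nonempty then
    (L.erase l).inf' h fun m => max 0 ((t - m) / (l - m)) else 1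

section Hat

variable {L : Finset ℝ} {l t a b : ℝ}

theorem continuous_hat (L : Finset ℝ) (l : ℝ) : Continuous (hat L l) := by
  unfold hat
  split_ifs with h
  · exact Continuous.finset_inf'_apply h fun m _ => by fun_prop
  · exact continuous_const

theorem hat_nonneg (L : Finset ℝ) (l t : ℝ) : 0 ≤ hat L l t := by
  unfold hat
  split_ifs with h
  · exact Finset.le_inf' _ _ fun m _ => le_max_left _ _
  · exact zero_le_one

theorem hat_self_pos (L : Finset ℝ) (l : ℝ) : 0 < hat L l l := by
  unfold hat
  split_ifs with h
  · refine (Finset.lt_inf'_iff _).2 fun m hm => ?_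
    rw [div_self (sub_ne_zero.2 (Finset.ne_of_mem_erase hm).symm)]
    simp
  · exact zero_lt_one

theorem hat_eq_of_isLeast {m : ℝ} (hm : m ∈ L) (hml : m ≠ l) (hnn : 0 ≤ (t - m) / (l - m))
    (h : ∀ k ∈ L, k ≠ l → (t - m) / (l - m) ≤ max 0 ((t - k) / (l - k))) :
    hat L l t = (t - m) / (l - m) := by
  have hmem : m ∈ L.erase l := Finset.mem_erase.2 ⟨hml, hm⟩
  rw [hat, dif_pos ⟨m, hmem⟩]
  refine le_antisymm ((Finset.inf'_le _ hmem).trans (max_le hnn le_rfl)) ?_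
  exact Finset.le_inf' _ _ fun k hk => h k (Finset.mem_of_mem_erase hk) (Finset.ne_of_mem_erase hk)

theorem hat_eq_zero {m : ℝ} (hm : m ∈ L) (hml : m ≠ l) (h : (t - m) / (l - m) ≤ 0) :
    hat L l t = 0 := by
  have hmem : m ∈ L.erase l := Finset.mem_erase.2 ⟨hml, hm⟩
  refine le_antisymm ?_ (hat_nonneg L l t)
  rw [hat, dif_pos ⟨m, hmem⟩]
  exact (Finset.inf'_le _ hmem).trans (max_le le_rfl h)

/-- On `[a, b]` the ramps from points below `a` are at least `1`, and those from points at or beyond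
`b` decrease fastest for the nearest one; so the minimum is the ramp from `b`. -/
theorem hat_left (hb : b ∈ L) (hab : a < b) (hgap : ∀ k ∈ L, k ≤ a ∨ b ≤ k)
    (hat' : a ≤ t) (htb : t ≤ b) : hat L a t = (b - t) / (b - a) := by
  have hba : 0 < b - a := by linarith
  have hflip : (b - t) / (b - a) = (t - b) / (a - b) := by
    rw [← neg_sub t b, ← neg_sub a b, neg_div_neg_eq]
  rw [hflip]
  refine hat_eq_of_isLeast hb hab.ne' (hflip ▸ div_nonneg (by linarith) hba.le) fun k hk hka => ?_
  rw [← hflip]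
  refine le_max_of_le_right ?_
  rcases hgap k hk with h | h
  · have hak : 0 < a - k := sub_pos.2 (lt_of_le_of_ne h hka)
    rw [div_le_div_iff₀ hba hak]
    nlinarith
  · rw [← neg_sub k t, ← neg_sub k a, neg_div_neg_eq, div_le_div_iff₀ hba (by linarith)]
    nlinarith

theorem hat_right (ha : a ∈ L) (hab : a < b) (hgap : ∀ k ∈ L, k ≤ a ∨ b ≤ k)
    (hat' : a ≤ t) (htb : t ≤ b) : hat L b t = (t - a) / (b - a) := by
  have hba : 0 < b - a := by linarith
  refine hat_eq_of_isLeast ha hab.ne (div_nonneg (by linarith) hba.le) fun k hk hkb => ?_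
  refine le_max_of_le_right ?_
  rcases hgap k hk with h | h
  · rw [div_le_div_iff₀ hba (by linarith)]
    nlinarith
  · have hbk : 0 < k - b := sub_pos.2 (lt_of_le_of_ne h (Ne.symm hkb))
    rw [← neg_sub k t, ← neg_sub k b, neg_div_neg_eq, div_le_div_iff₀ hba hbk]
    nlinarith

theorem hat_of_ne (ha : a ∈ L) (hb : b ∈ L) (hgap : ∀ k ∈ L, k ≤ a ∨ b ≤ k)
    (hat' : a ≤ t) (htb : t ≤ b) (hl : l ∈ L) (hla : l ≠ a) (hlb : l ≠ b) : hat L l t = 0 := by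
  rcases hgap l hl with h | h
  · exact hat_eq_zero ha hla.symm (div_nonpos_of_nonneg_of_nonpos (by linarith) (by linarith))
  · exact hat_eq_zero hb hlb.symm (div_nonpos_of_nonpos_of_nonneg (by linarith) (by linarith))

/-- Inside a gap only the hats of its two ends survive, and they are the barycentric coordinates of
`t`. This converts local interpolation into one global formula. -/
theorem sum_hat_smul {E : Type*} [AddCommGroup E] [Module ℝ E] (ha : a ∈ L) (hb : b ∈ L)
    (hab : a < b) (hgap : ∀ k ∈ L, k ≤ a ∨ b ≤ k) (hat' : a ≤ t) (htb : t ≤ b) (x : ℝ → E) :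
    ∑ l ∈ L, hat L l t • x l = ((b - t) / (b - a)) • x a + ((t - a) / (b - a)) • x b := by
  rw [Finset.sum_eq_add a b hab.ne (fun l hl hne => ?_) (fun h => absurd ha h)
    (fun h => absurd hb h), hat_left hb hab hgap hat' htb, hat_right ha hab hgap hat' htb]
  rw [hat_of_ne ha hb hgap hat' htb hl hne.1 hne.2, zero_smul]

theorem exists_consecutive {m M : ℝ} (hm : m ∈ L) (hM : M ∈ L) (hmM : m < M) (hmt : m ≤ t)
    (htM : t ≤ M) :
    ∃ a ∈ L, ∃ b ∈ L, a < b ∧ (∀ k ∈ L, k ≤ a ∨ b ≤ k) ∧ a ≤ t ∧ t ≤ b := by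
  -- Requiring `k < M` leaves a right neighbour even when `t = M`.
  have hne : (L.filter fun k => k ≤ t ∧ k < M).Nonempty := ⟨m, by simp [*]⟩
  obtain ⟨a, haf, hamax⟩ := (L.filter fun k => k ≤ t ∧ k < M).exists_max_image id hne
  obtain ⟨ha, hat', haM⟩ := Finset.mem_filter.1 haf
  have hne' : (L.filter fun k => a < k).Nonempty := ⟨M, by simp [*]⟩
  obtain ⟨b, hbf, hbmin⟩ := (L.filter fun k => a < k).exists_min_image id hne'
  obtain ⟨hb, hab⟩ := Finset.mem_filter.1 hbf
  refine ⟨a, ha, b, hb, hab, fun k hk => ?_, hat', ?_⟩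
  · by_contra! h
    exact (hbmin k (Finset.mem_filter.2 ⟨hk, h.1⟩)).not_gt h.2
  · by_contra! h
    exact (hamax b (Finset.mem_filter.2 ⟨hb, h.le, h.trans_le htM⟩)).not_gt hab

theorem integral_hat_pos {m M : ℝ} (hmM : m < M) (hml : m ≤ l) (hlM : l ≤ M) :
    0 < ∫ t in Set.Icc m M, hat L l t := by
  rw [MeasureTheory.integral_Icc_eq_integral_Ioc, ← intervalIntegral.integral_of_le hmM.le]
  exact intervalIntegral.integral_pos hmM (continuous_hat L l).continuousOn
    (fun t _ => hat_nonneg L l t) ⟨l, ⟨hml, hlM⟩, hat_self_pos L l⟩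

end Hat

/-! ### The monotone path polytope as a weighted sum -/

section MonotonePathPolytope

variable {d : ℕ} {P : Set (EuclideanSpace ℝ (Fin d))} {c : EuclideanSpace ℝ (Fin d)}

/-- The monotone path polytope is a weighted Minkowski sum of the sections at vertex levels. -/
theorem monotonePathPolytope_eq_sum (hP : IsPolytope P) {L : Finset ℝ} {m M : ℝ}
    (hm : m ∈ L) (hM : M ∈ L) (hmM : m < M) (hQ : projImage P c = Set.Icc m M)
    (hLQ : ∀ l ∈ L, l ∈ projImage P c) (hL : ∀ u ∈ P.extremePoints ℝ, inner ℝ u c ∈ L) :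
    monotonePathPolytope P c =
      ∑ l ∈ L, (∫ t in Set.Icc m M, hat L l t) • levelSection P c l := by
  have hne : ∀ l ∈ L, (levelSection P c l).Nonempty := fun l hl => by
    obtain ⟨x, hx, hxl⟩ := hLQ l hl
    exact ⟨x, hx, hxl⟩
  have hint : ∀ l, MeasureTheory.IntegrableOn (hat L l) (Set.Icc m M) := fun l =>
    (continuous_hat L l).continuousOn.integrableOn_compact isCompact_Icc
  ext y
  constructor
  · rintro ⟨γ, ⟨hγ, hsec⟩, rfl⟩
    rw [hQ] at hsec ⊢
    by_contra hy
    have hK : IsPolytope (∑ l ∈ L, (∫ t in Set.Icc m M, hat L l t) • levelSection P c l) :=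
      IsPolytope.sum fun l _ => (hP.levelSection c l).smul _
    -- Separation avoids choosing the interpolating points measurably in `t`: it is enough to bound
    -- `f (γ t)` using one fixed maximizer of `f` on each section.
    obtain ⟨f, u, hfK, hfu⟩ :=
      geometric_hahn_banach_closed_point hK.convex hK.isCompact.isClosed hy
    have hmax : ∀ l, ∃ x, l ∈ L → x ∈ levelSection P c l ∧ ∀ z ∈ levelSection P c l, f z ≤ f x := by
      intro l
      by_cases hl : l ∈ L
      · obtain ⟨x, hx, hmx⟩ := (hP.levelSection c l).isCompact.exists_isMaxOn (hne l hl)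
          f.continuous.continuousOn
        exact ⟨x, fun _ => ⟨hx, fun z hz => hmx hz⟩⟩
      · exact ⟨0, fun h => absurd h hl⟩
    choose x hx using hmax
    obtain ⟨C, hC⟩ := hP.isCompact.isBounded.exists_norm_le
    have hγint : MeasureTheory.IntegrableOn γ (Set.Icc m M) := by
      refine MeasureTheory.Measure.integrableOn_of_bounded (M := C)
        isCompact_Icc.measure_lt_top.ne hγ.aestronglyMeasurable ?_
      exact (MeasureTheory.ae_restrict_mem measurableSet_Icc).mono fun t ht => hC _ (hsec t ht).1
    have hpt : ∀ t ∈ Set.Icc m M, f (γ t) ≤ ∑ l ∈ L, hat L l t * f (x l) := by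
      intro t ht
      obtain ⟨a, ha, b, hb, hab, hgap, hat', htb⟩ := exists_consecutive hm hM hmM ht.1 ht.2
      have hγt : γ t ∈ levelSection (convexHull ℝ (P.extremePoints ℝ)) c t := by
        rw [hP.convexHull_extremePoints]
        exact hsec t ht
      obtain ⟨y, hy, z, hz, h⟩ := exists_eq_interpolation hab (fun u hu => hgap _ (hL u hu))
        (by rw [hP.convexHull_extremePoints]; exact hne a ha)
        (by rw [hP.convexHull_extremePoints]; exact hne b hb) hat' htb hγt
      rw [hP.convexHull_extremePoints] at hy hz
      have hsum := sum_hat_smul ha hb hab hgap hat' htb fun l => f (x l)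
      simp only [smul_eq_mul] at hsum
      rw [hsum, h, map_add, map_smul, map_smul, smul_eq_mul, smul_eq_mul]
      exact add_le_add
        (mul_le_mul_of_nonneg_left ((hx a ha).2 y hy) (div_nonneg (by linarith) (by linarith)))
        (mul_le_mul_of_nonneg_left ((hx b hb).2 z hz) (div_nonneg (by linarith) (by linarith)))
    have hle : f (∫ t in Set.Icc m M, γ t) ≤
        f (∑ l ∈ L, (∫ t in Set.Icc m M, hat L l t) • x l) := by
      rw [← f.integral_comp_comm hγint, map_sum]
      refine (MeasureTheory.setIntegral_mono_on (f.integrable_comp hγint)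
        (MeasureTheory.integrable_finsetSum _ fun l _ => (hint l).mul_const (f (x l)))
        measurableSet_Icc hpt).trans_eq ?_
      rw [MeasureTheory.integral_finsetSum _ fun l _ => (hint l).mul_const (f (x l))]
      refine Finset.sum_congr rfl fun l _ => ?_
      rw [MeasureTheory.integral_mul_const, map_smul, smul_eq_mul]
    exact lt_irrefl _ (hfu.trans_le (hle.trans (hfK _ (Set.finsetSum_mem_finsetSum _ _ _ fun l hl =>
      Set.smul_mem_smul_set (hx l hl).1)).le))
  · intro hy
    rw [Set.mem_finsetSum] at hy
    obtain ⟨g, hg, rfl⟩ := hy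
    have hg' : ∀ l, ∃ x, l ∈ L → x ∈ levelSection P c l ∧
        (∫ t in Set.Icc m M, hat L l t) • x = g l := by
      intro l
      by_cases hl : l ∈ L
      · obtain ⟨x, hx, h⟩ := hg hl
        exact ⟨x, fun _ => ⟨hx, h⟩⟩
      · exact ⟨0, fun h => absurd h hl⟩
    choose x hx using hg'
    -- The piecewise linear path through the chosen points `x l`.
    refine ⟨fun t => ∑ l ∈ L, hat L l t • x l, ⟨?_, fun t ht => ?_⟩, ?_⟩
    · exact (continuous_finsetSum _ fun l _ =>
        (continuous_hat L l).smul continuous_const).measurable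
    · rw [hQ] at ht
      obtain ⟨a, ha, b, hb, hab, hgap, hat', htb⟩ := exists_consecutive hm hM hmM ht.1 ht.2
      have hba : b - a ≠ 0 := by linarith
      beta_reduce
      rw [sum_hat_smul ha hb hab hgap hat' htb]
      refine ⟨hP.convex (hx a ha).1.1 (hx b hb).1.1 (div_nonneg (by linarith) (by linarith))
        (div_nonneg (by linarith) (by linarith)) (by field_simp; ring), ?_⟩
      rw [inner_add_left, real_inner_smul_left, real_inner_smul_left, (hx a ha).1.2,
        (hx b hb).1.2]
      field_simp
      ring
    · rw [hQ, MeasureTheory.integral_finsetSum _ fun l _ => (hint l).smul_const (x l)]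
      refine Finset.sum_congr rfl fun l hl => ?_
      rw [integral_smul_const, (hx l hl).2]

end MonotonePathPolytope

/-! ### Normal fans and Minkowski sums -/

/-- The face of `P` at which the linear functional `⟪w, ·⟫` is maximal. -/
def maxFace {d : ℕ} (P : Set (EuclideanSpace ℝ (Fin d))) (w : EuclideanSpace ℝ (Fin d)) :
    Set (EuclideanSpace ℝ (Fin d)) :=
  {x | x ∈ P ∧ ∀ y ∈ P, inner ℝ w y ≤ inner ℝ w x}

section NormalFan

variable {d : ℕ} {P R : Set (EuclideanSpace ℝ (Fin d))} {w w₀ : EuclideanSpace ℝ (Fin d)}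

theorem maxFace_nonempty (hP : IsCompact P) (hne : P.Nonempty) (w : EuclideanSpace ℝ (Fin d)) :
    (maxFace P w).Nonempty := by
  obtain ⟨x, hx, hmax⟩ := hP.exists_isMaxOn hne (f := fun y => inner ℝ w y)
    (by fun_prop)
  exact ⟨x, hx, fun y hy => hmax hy⟩

theorem maxFace_of_subsingleton (hP : P.Subsingleton) (w : EuclideanSpace ℝ (Fin d)) :
    maxFace P w = P :=
  Set.Subset.antisymm (fun _ hx => hx.1) fun x hx => ⟨hx, fun y hy => by rw [hP hy hx]⟩

theorem isExposed_maxFace (P : Set (EuclideanSpace ℝ (Fin d))) (w : EuclideanSpace ℝ (Fin d)) :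
    IsExposed ℝ P (maxFace P w) :=
  fun _ => ⟨innerSL ℝ w, rfl⟩

/-- By Riesz duality the nonempty exposed faces are exactly the sets `maxFace P w₀`, so the fan is
encoded by inclusions between maximal faces. -/
theorem normalFan_eq_range (hP : IsCompact P) (hne : P.Nonempty) :
    normalFan P = Set.range fun w₀ => {w | maxFace P w₀ ⊆ maxFace P w} := by
  have hcone : ∀ F ⊆ P, normalCone P F = {w | F ⊆ maxFace P w} := fun F hF =>
    Set.ext fun w => ⟨fun h x hx => ⟨hF hx, h x hx⟩, fun h x hx => (h hx).2⟩
  ext C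
  constructor
  · rintro ⟨F, hFP, hF, hexp, rfl⟩
    obtain ⟨l, hl⟩ := hexp hF
    refine ⟨(InnerProductSpace.toDual ℝ _).symm l, ?_⟩
    have hFl : F = maxFace P ((InnerProductSpace.toDual ℝ _).symm l) := by
      simp only [hl, maxFace, InnerProductSpace.toDual_symm_apply]
    beta_reduce
    rw [hcone F hFP, ← hFl]
  · rintro ⟨w₀, rfl⟩
    exact ⟨maxFace P w₀, fun _ hx => hx.1, maxFace_nonempty hP hne w₀, isExposed_maxFace P w₀,
      (hcone _ fun _ hx => hx.1).symm⟩

theorem normalFan_eq_of_maxFace_subset_iff (hP : IsCompact P) (hPne : P.Nonempty)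
    (hR : IsCompact R) (hRne : R.Nonempty)
    (h : ∀ w₀ w, maxFace P w₀ ⊆ maxFace P w ↔ maxFace R w₀ ⊆ maxFace R w) :
    normalFan P = normalFan R := by
  simp only [normalFan_eq_range hP hPne, normalFan_eq_range hR hRne, h]

theorem smul_mem_maxFace_smul_iff {a : ℝ} (ha : 0 < a) {x : EuclideanSpace ℝ (Fin d)} :
    a • x ∈ maxFace (a • P) w ↔ x ∈ maxFace P w := by
  refine and_congr (Set.smul_mem_smul_set_iff₀ ha.ne' P x) ?_
  simp only [← Set.image_smul, Set.forall_mem_image, inner_smul_right, mul_le_mul_iff_right₀ ha]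

theorem maxFace_smul_subset_iff {a : ℝ} (ha : 0 < a) :
    maxFace (a • P) w₀ ⊆ maxFace (a • P) w ↔ maxFace P w₀ ⊆ maxFace P w := by
  constructor
  · intro h x hx
    exact (smul_mem_maxFace_smul_iff ha).1 (h ((smul_mem_maxFace_smul_iff ha).2 hx))
  · rintro h y hy
    obtain ⟨x, -, rfl⟩ := hy.1
    exact (smul_mem_maxFace_smul_iff ha).2 (h ((smul_mem_maxFace_smul_iff ha).1 hy))

theorem sum_mem_maxFace_sum_iff {ι : Type*} {I : Finset ι}
    {A : ι → Set (EuclideanSpace ℝ (Fin d))} {g : ι → EuclideanSpace ℝ (Fin d)}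
    (hg : ∀ i ∈ I, g i ∈ A i) :
    ∑ i ∈ I, g i ∈ maxFace (∑ i ∈ I, A i) w ↔ ∀ i ∈ I, g i ∈ maxFace (A i) w := by
  classical
  constructor
  · rintro ⟨-, h⟩ i hi
    refine ⟨hg i hi, fun z hz => ?_⟩
    -- Compare with the competitor that replaces only the `i`-th summand.
    have hmem : ∑ j ∈ I, Function.update g i z j ∈ ∑ j ∈ I, A j := by
      refine Set.finsetSum_mem_finsetSum _ _ _ fun j hj => ?_
      rcases eq_or_ne j i with rfl | hji
      · simpa using hz
      · simpa [hji] using hg j hj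
    have := h _ hmem
    rw [Finset.sum_update_of_mem hi, ← Finset.add_sum_erase I g hi, Finset.sdiff_singleton_eq_erase,
      inner_add_right, inner_add_right] at this
    linarith
  · intro h
    refine ⟨Set.finsetSum_mem_finsetSum _ _ _ hg, fun y hy => ?_⟩
    rw [Set.mem_finsetSum] at hy
    obtain ⟨k, hk, rfl⟩ := hy
    rw [inner_sum, inner_sum]
    exact Finset.sum_le_sum fun i hi => (h i hi).2 _ (hk hi)

theorem maxFace_sum_subset_iff {ι : Type*} {I : Finset ι}
    {A : ι → Set (EuclideanSpace ℝ (Fin d))} (hA : ∀ i ∈ I, IsCompact (A i))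
    (hne : ∀ i ∈ I, (A i).Nonempty) :
    maxFace (∑ i ∈ I, A i) w₀ ⊆ maxFace (∑ i ∈ I, A i) w ↔
      ∀ i ∈ I, maxFace (A i) w₀ ⊆ maxFace (A i) w := by
  classical
  constructor
  · intro h i hi x hx
    have hex : ∀ j, ∃ y, j ∈ I → y ∈ maxFace (A j) w₀ := fun j => by
      by_cases hj : j ∈ I
      · exact (maxFace_nonempty (hA j hj) (hne j hj) w₀).imp fun y hy _ => hy
      · exact ⟨0, fun h => absurd h hj⟩
    -- Maximizers in the other summands complete `x` to a maximizer of the whole sum; nonemptiness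
    -- and compactness provide them.
    choose g hg using hex
    have hg' : ∀ j ∈ I, Function.update g i x j ∈ maxFace (A j) w₀ := fun j hj => by
      rcases eq_or_ne j i with rfl | hji
      · simpa using hx
      · simpa [hji] using hg j hj
    have hmem : ∀ j ∈ I, Function.update g i x j ∈ A j := fun j hj => (hg' j hj).1
    have := (sum_mem_maxFace_sum_iff hmem).1 (h ((sum_mem_maxFace_sum_iff hmem).2 hg')) i hi
    simpa using this
  · intro h y hy
    obtain ⟨g, hg, rfl⟩ := (Set.mem_finsetSum _ _ _).1 hy.1
    have hmem : ∀ i ∈ I, g i ∈ A i := fun i hi => hg hi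
    exact (sum_mem_maxFace_sum_iff hmem).2 fun i hi =>
      h i hi ((sum_mem_maxFace_sum_iff hmem).1 hy i hi)

theorem finsetSum_set_nonempty {ι : Type*} {I : Finset ι} {A : ι → Set (EuclideanSpace ℝ (Fin d))}
    (hne : ∀ i ∈ I, (A i).Nonempty) : (∑ i ∈ I, A i).Nonempty :=
  Finset.sum_induction A Set.Nonempty (fun _ _ => Set.Nonempty.add) Set.zero_nonempty hne

end NormalFan

/-! ### Existence of edges -/

section Edges

variable {d : ℕ} {P : Set (EuclideanSpace ℝ (Fin d))} {c : EuclideanSpace ℝ (Fin d)}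

theorem levelPoints_eq_of_forall_le {s : Set (EuclideanSpace ℝ (Fin d))} {t : ℝ}
    (h : ∀ u ∈ s, inner ℝ u c ≤ t) : levelPoints s c t = {u ∈ s | inner ℝ u c = t} := by
  ext z
  constructor
  · rintro ⟨u, hu, w, hw, hut, hwt, rfl⟩
    have hw' : inner ℝ w c = t := le_antisymm (h w hw) hwt
    -- If `u` is also at level `t`, the parameter is `0 / 0 = 0` and the point is `u`; otherwise the
    -- parameter is `1` and the point is `w`.
    rcases hut.eq_or_lt with hut | hut
    · simpa [levelPoint, hut, hw'] using And.intro hu hut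
    · have : t - inner ℝ u c ≠ 0 := by linarith
      simpa [levelPoint, hw', this] using And.intro hw hw'
  · rintro ⟨hu, hut⟩
    exact mem_levelPoints_self hu hut

theorem levelPoints_eq_of_forall_ge {s : Set (EuclideanSpace ℝ (Fin d))} {t : ℝ}
    (h : ∀ u ∈ s, t ≤ inner ℝ u c) : levelPoints s c t = {u ∈ s | inner ℝ u c = t} := by
  ext z
  constructor
  · rintro ⟨u, hu, w, hw, hut, hwt, rfl⟩
    have hu' : inner ℝ u c = t := le_antisymm hut (h u hu)
    simpa [levelPoint, hu'] using And.intro hu hu'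
  · rintro ⟨hu, hut⟩
    exact mem_levelPoints_self hu hut

/-- The points of `s` at which `⟪·, c⟫` is maximal. -/
noncomputable def maximizers (s : Finset (EuclideanSpace ℝ (Fin d)))
    (c : EuclideanSpace ℝ (Fin d)) : Finset (EuclideanSpace ℝ (Fin d)) := by
  classical exact s.filter fun x => ∀ y ∈ s, inner ℝ y c ≤ inner ℝ x c

theorem mem_maximizers {s : Finset (EuclideanSpace ℝ (Fin d))} {x : EuclideanSpace ℝ (Fin d)} :
    x ∈ maximizers s c ↔ x ∈ s ∧ ∀ y ∈ s, inner ℝ y c ≤ inner ℝ x c := by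
  classical
  simp [maximizers]

/-- The face is the section at the top level, where the level points are just the maximizers in `s`.
-/
theorem maxFace_convexHull {s : Finset (EuclideanSpace ℝ (Fin d))} (hs : s.Nonempty) :
    maxFace (convexHull ℝ (s : Set (EuclideanSpace ℝ (Fin d)))) c =
      convexHull ℝ (maximizers s c : Set (EuclideanSpace ℝ (Fin d))) := by
  obtain ⟨p, hp, hmax⟩ := s.exists_max_image (fun x => inner ℝ x c) hs
  have hle : ∀ x ∈ convexHull ℝ (s : Set (EuclideanSpace ℝ (Fin d))),
      inner ℝ x c ≤ inner ℝ p c :=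
    convexHull_min hmax (convex_setOf_inner_le c _)
  have h1 : maxFace (convexHull ℝ (s : Set (EuclideanSpace ℝ (Fin d)))) c =
      levelSection (convexHull ℝ (s : Set (EuclideanSpace ℝ (Fin d)))) c (inner ℝ p c) := by
    ext x
    simp only [maxFace, levelSection, Set.mem_ofPred_eq, real_inner_comm _ c]
    refine and_congr_right fun hx => ⟨fun h => le_antisymm (hle x hx)
      (h p (subset_convexHull ℝ _ hp)), fun h y hy => h ▸ hle y hy⟩
  have h2 : (maximizers s c : Set (EuclideanSpace ℝ (Fin d))) =
      {u ∈ (s : Set (EuclideanSpace ℝ (Fin d))) | inner ℝ u c = inner ℝ p c} := by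
    ext x
    simp only [Finset.mem_coe, mem_maximizers]
    exact and_congr_right fun hx => ⟨fun h => le_antisymm (hmax x hx) (h p hp),
      fun h y hy => h ▸ hmax y hy⟩
  rw [h1, h2, levelSection_convexHull, levelPoints_eq_of_forall_le hmax]

/-- Maximizers of a perturbed functional are maximizers, among the old ones, of the perturbation. -/
theorem exists_maximizers_perturbation {s : Finset (EuclideanSpace ℝ (Fin d))}
    {p g : EuclideanSpace ℝ (Fin d)} (hp : p ∈ maximizers s c)
    (hg : ∀ y ∈ maximizers s c, inner ℝ y g ≤ inner ℝ p g) :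
    ∃ c', ∀ x, x ∈ maximizers s c' ↔ x ∈ maximizers s c ∧ inner ℝ x g = inner ℝ p g := by
  obtain ⟨hps, hpmax⟩ := mem_maximizers.1 hp
  have hlt : ∀ y ∈ s, y ∉ maximizers s c → inner ℝ y c < inner ℝ p c := by
    intro y hy hyc
    refine lt_of_le_of_ne (hpmax y hy) fun h => hyc (mem_maximizers.2 ⟨hy, fun z hz => ?_⟩)
    rw [h]
    exact hpmax z hz
  -- Finitely many strict inequalities survive a small perturbation, so `c + ε • g` works.
  have hev : ∀ᶠ ε : ℝ in nhdsWithin 0 (Set.Ioi 0), ∀ y ∈ s, y ∉ maximizers s c →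
      inner ℝ y c + ε * inner ℝ y g < inner ℝ p c + ε * inner ℝ p g := by
    refine (Filter.eventually_all_finset s).2 fun y hy => ?_
    by_cases hyc : y ∈ maximizers s c
    · exact Filter.Eventually.of_forall fun ε h => absurd hyc h
    · refine Filter.Eventually.mono ?_ fun ε h _ => h
      refine nhdsWithin_le_nhds (ContinuousAt.eventually_lt (by fun_prop) (by fun_prop) ?_)
      simpa using hlt y hy hyc
  obtain ⟨ε, hε, hεpos⟩ := (hev.and self_mem_nhdsWithin).exists
  have hεpos : 0 < ε := hεpos
  have hexp : ∀ y, inner ℝ y (c + ε • g) = inner ℝ y c + ε * inner ℝ y g := fun y => by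
    rw [inner_add_right, inner_smul_right]
  have hle : ∀ y ∈ s, inner ℝ y (c + ε • g) ≤ inner ℝ p (c + ε • g) := by
    intro y hy
    rw [hexp, hexp]
    by_cases hyc : y ∈ maximizers s c
    · exact add_le_add (hpmax y hy) (mul_le_mul_of_nonneg_left (hg y hyc) hεpos.le)
    · exact (hε y hy hyc).le
  refine ⟨c + ε • g, fun x => ⟨fun hx => ?_, fun ⟨hx, hxg⟩ => ?_⟩⟩
  · obtain ⟨hxs, hxmax⟩ := mem_maximizers.1 hx
    have h := hxmax p hps
    rw [hexp, hexp] at h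
    have hxc : x ∈ maximizers s c := by
      by_contra hxc
      exact (hε x hxs hxc).not_ge h
    refine ⟨hxc, le_antisymm (hg x hxc) ?_⟩
    have := hpmax x hxs
    exact le_of_mul_le_mul_left (by linarith) hεpos
  · obtain ⟨hxs, hxmax⟩ := mem_maximizers.1 hx
    refine mem_maximizers.2 ⟨hxs, fun y hy => (hle y hy).trans ?_⟩
    rw [hexp, hexp, hxg]
    linarith [hxmax p hps]

/-- A functional whose maximum on the non-collinear finite set `T` is attained at `p` and at another
point, but not at `q`. -/
theorem exists_functional_of_not_collinear {T : Finset (EuclideanSpace ℝ (Fin d))}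
    {p q x : EuclideanSpace ℝ (Fin d)}
    (hstrict : ∀ y ∈ T, y ≠ p → inner ℝ y p < inner ℝ p p) (hq : q ∈ T) (hqp : q ≠ p) (hx : x ∈ T)
    (hxq : ∀ r : ℝ, x - p ≠ r • (q - p)) :
    ∃ g, (∀ y ∈ T, inner ℝ y g ≤ inner ℝ p g) ∧ (∃ y ∈ T, y ≠ p ∧ inner ℝ y g = inner ℝ p g) ∧
      inner ℝ q g < inner ℝ p g := by
  set e := q - p with he
  -- `h` is the component of `x - p` orthogonal to `q - p`. Tilting the functional `p` along `h`
  -- keeps the deficit of `q` unchanged; the minimal ratio `m` below is the first tilt at which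
  -- another point ties with `p`.
  set r := inner ℝ (x - p) e / inner ℝ e e with hr
  set h := (x - p) - r • e with hh
  have he0 : inner ℝ e e ≠ 0 := inner_self_ne_zero.2 (sub_ne_zero.2 hqp)
  have heh : inner ℝ e h = 0 := by
    rw [hh, inner_sub_right, inner_smul_right, hr, real_inner_comm]
    field_simp
    ring
  have hxh : 0 < inner ℝ (x - p) h := by
    have h0 : h ≠ 0 := sub_ne_zero.2 (hxq r)
    have h1 : x - p = h + r • e := by rw [hh]; abel
    rw [h1, inner_add_left, real_inner_smul_left, heh, mul_zero, add_zero]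
    exact real_inner_self_pos.2 h0
  have hqh : inner ℝ q h = inner ℝ p h := by
    rw [he, inner_sub_left] at heh
    linarith
  rw [inner_sub_left] at hxh
  have hne : (T.filter fun y => inner ℝ p h < inner ℝ y h).Nonempty :=
    ⟨x, Finset.mem_filter.2 ⟨hx, by linarith⟩⟩
  obtain ⟨z, hz, hzmin⟩ := (T.filter fun y => inner ℝ p h < inner ℝ y h).exists_min_image
    (fun y => (inner ℝ p p - inner ℝ y p) / (inner ℝ y h - inner ℝ p h)) hne
  obtain ⟨hzT, hzh⟩ := Finset.mem_filter.1 hz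
  set m := (inner ℝ p p - inner ℝ z p) / (inner ℝ z h - inner ℝ p h) with hm
  have hzp : z ≠ p := by
    rintro rfl
    exact lt_irrefl _ hzh
  have hm0 : 0 ≤ m := div_nonneg (by linarith [hstrict z hzT hzp]) (by linarith)
  have hexp : ∀ y, inner ℝ y (p + m • h) = inner ℝ y p + m * inner ℝ y h := fun y => by
    rw [inner_add_right, inner_smul_right]
  refine ⟨p + m • h, fun y hy => ?_, ⟨z, hzT, hzp, ?_⟩, ?_⟩
  · rw [hexp, hexp]
    rcases eq_or_ne y p with rfl | hyp
    · exact le_rfl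
    by_cases hyh : inner ℝ p h < inner ℝ y h
    · have := hzmin y (Finset.mem_filter.2 ⟨hy, hyh⟩)
      rw [le_div_iff₀ (by linarith)] at this
      linarith
    · have := mul_le_mul_of_nonneg_left (not_lt.1 hyh) hm0
      linarith [hstrict y hy hyp]
  · rw [hexp, hexp]
    have : m * (inner ℝ z h - inner ℝ p h) = inner ℝ p p - inner ℝ z p :=
      div_mul_cancel₀ _ (by linarith)
    linarith
  · rw [hexp, hexp, hqh]
    linarith [hstrict q hq hqp]

/-- A point of largest norm works: expand `‖y - p‖ ^ 2 > 0`. -/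
theorem exists_strict_maximizer {T : Finset (EuclideanSpace ℝ (Fin d))} (hT : T.Nonempty) :
    ∃ p ∈ T, ∀ y ∈ T, y ≠ p → inner ℝ y p < inner ℝ p p := by
  obtain ⟨p, hp, hmax⟩ := T.exists_max_image (fun x => ‖x‖) hT
  refine ⟨p, hp, fun y hy hyp => ?_⟩
  have h1 : 0 < ‖y - p‖ ^ 2 := by
    have := norm_pos_iff.2 (sub_ne_zero.2 hyp)
    positivity
  have h2 := norm_sub_sq_real y p
  have h3 : ‖y‖ ^ 2 ≤ ‖p‖ ^ 2 := pow_le_pow_left₀ (norm_nonneg y) (hmax y hy) 2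
  rw [real_inner_self_eq_norm_sq]
  linarith

/-- A polytope with at least two points has an edge. -/
theorem IsPolytope.exists_isEdge (hP : IsPolytope P) (hnt : P.Nontrivial) :
    ∃ u v, IsEdge P u v := by
  obtain ⟨s', hs', rfl⟩ := hP
  lift s' to Finset (EuclideanSpace ℝ (Fin d)) using hs' with s
  have hsne : s.Nonempty := Finset.coe_nonempty.1 (convexHull_nonempty_iff.1 hnt.nonempty)
  have hsnt : s.Nontrivial := by
    rw [← Finset.nontrivial_coe, ← Set.not_subsingleton_iff]
    intro h
    obtain ⟨x, hx⟩ := (h.eq_empty_or_singleton).resolve_left (Finset.coe_nonempty.2 hsne).ne_empty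
    rw [hx, convexHull_singleton] at hnt
    exact Set.not_nontrivial_singleton hnt
  -- Take a functional with the fewest maximizers among those having at least two; the zero
  -- functional is a candidate.
  obtain ⟨c, hc, hmin⟩ := (measure fun c => (maximizers s c).card).wf.has_min
    {c | (maximizers s c).Nontrivial} ⟨0, by
      have h0 : maximizers s 0 = s := by
        ext x
        simp [mem_maximizers]
      rwa [Set.mem_ofPred_eq, h0]⟩
  have hc : (maximizers s c).Nontrivial := hc
  set T := maximizers s c with hT
  obtain ⟨p, hp, hstrict⟩ := exists_strict_maximizer hc.nonempty
  obtain ⟨q, hq, hqmin⟩ := T.exists_min_image (fun x => inner ℝ x p) hc.nonempty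
  have hqp : q ≠ p := by
    rintro rfl
    obtain ⟨y, hy, hyq⟩ := hc.exists_ne q
    exact (hqmin y hy).not_gt (hstrict y hy hyq)
  have hqlt := hstrict q hq hqp
  -- Otherwise a perturbation would discard `q` and still keep two maximizers.
  have hcol : ∀ x ∈ T, ∃ r : ℝ, x - p = r • (q - p) := by
    by_contra! hcon
    obtain ⟨x, hx, hxq⟩ := hcon
    obtain ⟨g, hg, ⟨y, hy, hyp, hyg⟩, hqg⟩ :=
      exists_functional_of_not_collinear hstrict hq hqp hx hxq
    obtain ⟨c', hc'⟩ := exists_maximizers_perturbation hp hg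
    refine hmin c' ⟨p, (hc' p).2 ⟨hp, rfl⟩, y, (hc' y).2 ⟨hy, hyg⟩, hyp.symm⟩ ?_
    refine Finset.card_lt_card ⟨fun z hz => ((hc' z).1 hz).1, fun hsub => ?_⟩
    exact hqg.ne ((hc' q).1 (hsub hq)).2
  -- The maximizers lie on the line through `p` and `q`, and `⟪·, p⟫` is maximal at `p` and minimal
  -- at `q`, so none lies outside the segment.
  have hseg : segment ℝ p q = maxFace (convexHull ℝ (s : Set (EuclideanSpace ℝ (Fin d)))) c := by
    rw [maxFace_convexHull hsne]
    refine Set.Subset.antisymm (segment_subset_convexHull hp hq)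
      (convexHull_min (fun x hx => ?_) (convex_segment p q))
    obtain ⟨r, hr⟩ := hcol x hx
    have h1 : inner ℝ x p - inner ℝ p p = r * (inner ℝ q p - inner ℝ p p) := by
      rw [← inner_sub_left, ← inner_sub_left, hr, real_inner_smul_left]
    have h2 := hqmin x hx
    have h3 : inner ℝ x p ≤ inner ℝ p p := by
      rcases eq_or_ne x p with rfl | hxp
      · exact le_rfl
      · exact (hstrict x hx hxp).le
    rw [segment_eq_image']
    refine ⟨r, ⟨?_, ?_⟩, by simp [← hr]⟩
    · by_contra! hr0
      nlinarith
    · by_contra! hr1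
      nlinarith
  refine ⟨p, q, hqp.symm, ?_, ?_⟩
  · rw [hseg]
    exact fun _ hx => hx.1
  · rw [hseg]
    exact isExposed_maxFace _ c

end Edges

/-! ### Degenerate cases and the main theorem -/

section Main

variable {d : ℕ} {P : Set (EuclideanSpace ℝ (Fin d))} {c : EuclideanSpace ℝ (Fin d)}

theorem monotonePathPolytope_of_subsingleton (hP : P.Subsingleton) :
    monotonePathPolytope P c = 0 := by
  have hzero : ∀ γ : ℝ → EuclideanSpace ℝ (Fin d), ∫ t in projImage P c, γ t = 0 := fun γ => by
    refine MeasureTheory.setIntegral_measure_zero γ ?_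
    exact (hP.image _).measure_zero _
  refine Set.Subset.antisymm ?_ ?_
  · rintro y ⟨γ, -, rfl⟩
    exact hzero γ
  · rintro y rfl
    -- For empty `P` every measurable map is vacuously a section, so the result is still `{0}`.
    rcases P.eq_empty_or_nonempty with rfl | ⟨x, hx⟩
    · exact ⟨0, ⟨measurable_const, by simp [projImage]⟩, (hzero 0).symm⟩
    · refine ⟨fun _ => x, ⟨measurable_const, ?_⟩, (hzero _).symm⟩
      rintro t ⟨y, hy, rfl⟩
      exact ⟨hx, by rw [hP hx hy]⟩

theorem projImage_eq_Icc (hP : Convex ℝ P) {x y : EuclideanSpace ℝ (Fin d)} (hx : x ∈ P)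
    (hy : y ∈ P) (h : ∀ z ∈ P, inner ℝ x c ≤ inner ℝ z c ∧ inner ℝ z c ≤ inner ℝ y c) :
    projImage P c = Set.Icc (inner ℝ x c) (inner ℝ y c) := by
  refine Set.Subset.antisymm ?_ fun t ht => ?_
  · rintro t ⟨z, hz, rfl⟩
    exact h z hz
  · exact ⟨levelPoint c t x y, hP.segment_subset hx hy (levelPoint_mem_segment ht.1 ht.2),
      inner_levelPoint ht.1 ht.2⟩

/-- At a supporting level the section is the hull of the vertices at that level, here at most one.
-/
theorem subsingleton_levelSection (hP : IsPolytope P) {x : EuclideanSpace ℝ (Fin d)} {t : ℝ}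
    (h : (∀ u ∈ P.extremePoints ℝ, t ≤ inner ℝ u c) ∨ ∀ u ∈ P.extremePoints ℝ, inner ℝ u c ≤ t)
    (hx : ∀ u ∈ P.extremePoints ℝ, inner ℝ u c = t → u = x) :
    (levelSection P c t).Subsingleton := by
  have hpts : levelPoints (P.extremePoints ℝ) c t ⊆ {x} := by
    rw [h.elim levelPoints_eq_of_forall_ge levelPoints_eq_of_forall_le]
    exact fun u hu => hx u hu.1 hu.2
  rw [← hP.convexHull_extremePoints, levelSection_convexHull]
  exact Set.subsingleton_singleton.anti (convexHull_min hpts (convex_singleton x))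

end Main

theorem mainTheorem11 {d : ℕ} (P : Set (EuclideanSpace ℝ (Fin d)))
    (c : EuclideanSpace ℝ (Fin d)) (hP : IsPolytope P) (hc : IsGenericDirection P c)
    (n : ℕ) (v : ℕ → EuclideanSpace ℝ (Fin d)) (q : ℕ → ℝ)
    (hv : Set.BijOn v (Set.Icc 1 n) (P.extremePoints ℝ))
    (hq : ∀ i ∈ Set.Icc 1 n, q i = inner ℝ (v i) c)
    (hmono : MonotoneOn q (Set.Icc 1 n)) :
    NormallyEquivalent (monotonePathPolytope P c)
      (∑ i ∈ Finset.Icc 2 (n - 1), levelSection P c (q i)) := by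
  rcases P.subsingleton_or_nontrivial with hss | hnt
  · have hn : n ≤ 1 := by
      by_contra! hn
      have h1 : 1 ∈ Set.Icc 1 n := ⟨le_rfl, hn.le⟩
      have h2 : 2 ∈ Set.Icc 1 n := ⟨one_le_two, hn⟩
      have := hv.injOn h1 h2 (hss (hv.mapsTo h1).1 (hv.mapsTo h2).1)
      omega
    rw [Finset.Icc_eq_empty (by omega), Finset.sum_empty, monotonePathPolytope_of_subsingleton hss]
    exact ⟨isPolytope_zero, isPolytope_zero, rfl⟩
  have hvP : ∀ i ∈ Set.Icc 1 n, v i ∈ P := fun i hi => (hv.mapsTo hi).1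
  have hext : ∀ u ∈ P.extremePoints ℝ, ∃ i ∈ Set.Icc 1 n, v i = u := fun u hu => hv.surjOn hu
  have hn : 1 ≤ n := by
    have hne : (P.extremePoints ℝ).Nonempty := by
      rw [← convexHull_nonempty_iff (𝕜 := ℝ), hP.convexHull_extremePoints]
      exact hnt.nonempty
    obtain ⟨u, hu⟩ := hne
    obtain ⟨i, hi, -⟩ := hext u hu
    exact hi.1.trans hi.2
  have h1 : 1 ∈ Set.Icc 1 n := ⟨le_rfl, hn⟩
  have hn' : n ∈ Set.Icc 1 n := ⟨hn, le_rfl⟩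
  have hlow : ∀ u ∈ P.extremePoints ℝ, q 1 ≤ inner ℝ u c := fun u hu => by
    obtain ⟨i, hi, rfl⟩ := hext u hu
    exact hq i hi ▸ hmono h1 hi hi.1
  have hupp : ∀ u ∈ P.extremePoints ℝ, inner ℝ u c ≤ q n := fun u hu => by
    obtain ⟨i, hi, rfl⟩ := hext u hu
    exact hq i hi ▸ hmono hi hn' hi.2
  have hbd : ∀ z ∈ P, q 1 ≤ inner ℝ z c ∧ inner ℝ z c ≤ q n := fun z hz => by
    rw [← hP.convexHull_extremePoints] at hz
    exact ⟨convexHull_min hlow (convex_setOf_le_inner c _) hz,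
      convexHull_min hupp (convex_setOf_inner_le c _) hz⟩
  -- The only use of genericity.
  have hlt : q 1 < q n := by
    obtain ⟨u, w, hedge⟩ := hP.exists_isEdge hnt
    have hne := hc u w hedge
    rw [real_inner_comm, inner_sub_left, sub_ne_zero] at hne
    obtain ⟨hu1, hu2⟩ := hbd u (hedge.2.1 (left_mem_segment ℝ u w))
    obtain ⟨hw1, hw2⟩ := hbd w (hedge.2.1 (right_mem_segment ℝ u w))
    rcases hne.lt_or_gt with h | h <;> linarith
  have hQ : projImage P c = Set.Icc (q 1) (q n) := by
    rw [hq 1 h1, hq n hn']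
    refine projImage_eq_Icc hP.convex (hvP 1 h1) (hvP n hn') fun z hz => ?_
    rw [← hq 1 h1, ← hq n hn']
    exact hbd z hz
  -- Vertices sharing a level are merged here, whereas the sum over indices repeats their section.
  set L : Finset ℝ := (Finset.Icc 1 n).image q with hL
  have hLmem : ∀ i ∈ Set.Icc 1 n, q i ∈ L := fun i hi =>
    Finset.mem_image_of_mem q (Finset.mem_Icc.2 hi)
  have hLex : ∀ l ∈ L, ∃ i ∈ Set.Icc 1 n, q i = l := fun l hl => by
    obtain ⟨i, hi, rfl⟩ := Finset.mem_image.1 hl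
    exact ⟨i, Finset.mem_Icc.1 hi, rfl⟩
  have hLQ : ∀ l ∈ L, l ∈ Set.Icc (q 1) (q n) := fun l hl => by
    obtain ⟨i, hi, rfl⟩ := hLex l hl
    exact ⟨hmono h1 hi hi.1, hmono hi hn' hi.2⟩
  have hpoly : ∀ t, IsPolytope (levelSection P c t) := hP.levelSection c
  have hsecne : ∀ i ∈ Set.Icc 1 n, (levelSection P c (q i)).Nonempty := fun i hi =>
    ⟨v i, hvP i hi, (hq i hi).symm⟩
  have hinner : ∀ i ∈ Finset.Icc 2 (n - 1), i ∈ Set.Icc 1 n := fun i hi => by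
    rw [Finset.mem_Icc] at hi
    exact ⟨by omega, by omega⟩
  have hLne : ∀ l ∈ L, (levelSection P c l).Nonempty := fun l hl => by
    obtain ⟨i, hi, rfl⟩ := hLex l hl
    exact hsecne i hi
  have hpos : ∀ l ∈ L, 0 < ∫ t in Set.Icc (q 1) (q n), hat L l t := fun l hl =>
    integral_hat_pos hlt (hLQ l hl).1 (hLQ l hl).2
  have hM := monotonePathPolytope_eq_sum (c := c) hP (hLmem 1 h1) (hLmem n hn') hlt hQ
    (fun l hl => hQ ▸ hLQ l hl) fun u hu => by
      obtain ⟨i, hi, rfl⟩ := hext u hu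
      exact hq i hi ▸ hLmem i hi
  have hMpoly : IsPolytope (monotonePathPolytope P c) := by
    rw [hM]
    exact IsPolytope.sum fun l _ => (hpoly l).smul _
  have hSpoly : IsPolytope (∑ i ∈ Finset.Icc 2 (n - 1), levelSection P c (q i)) :=
    IsPolytope.sum fun i _ => hpoly (q i)
  have hMne : (monotonePathPolytope P c).Nonempty := by
    rw [hM]
    exact finsetSum_set_nonempty fun l hl => (hLne l hl).smul_set
  refine ⟨hMpoly, hSpoly, normalFan_eq_of_maxFace_subset_iff hMpoly.isCompact hMne
    hSpoly.isCompact (finsetSum_set_nonempty fun i hi => hsecne i (hinner i hi)) fun w₀ w => ?_⟩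
  rw [hM, maxFace_sum_subset_iff (fun l _ => ((hpoly l).smul _).isCompact)
    fun l hl => (hLne l hl).smul_set, maxFace_sum_subset_iff (fun i _ => (hpoly (q i)).isCompact)
    fun i hi => hsecne i (hinner i hi)]
  refine ⟨fun h i hi => (maxFace_smul_subset_iff (hpos _ (hLmem i (hinner i hi)))).1
    (h _ (hLmem i (hinner i hi))), fun h l hl => (maxFace_smul_subset_iff (hpos l hl)).2 ?_⟩
  by_cases hex : ∃ i ∈ Finset.Icc 2 (n - 1), q i = l
  · obtain ⟨i, hi, rfl⟩ := hex
    exact h i hi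
  -- Only the first and last vertices can lie at this level, and not both since `q 1 < q n`.
  have hend : ∀ i ∈ Set.Icc 1 n, q i = l → i = 1 ∨ i = n := fun i hi hil => by
    by_contra! hne
    have := hi.1
    have := hi.2
    exact hex ⟨i, Finset.mem_Icc.2 ⟨by omega, by omega⟩, hil⟩
  obtain ⟨j, hj, rfl⟩ := hLex l hl
  have hsub : (levelSection P c (q j)).Subsingleton := by
    refine subsingleton_levelSection hP (x := v j) ?_ fun u hu hut => ?_
    · rcases hend j hj rfl with rfl | rfl
      · exact Or.inl hlow
      · exact Or.inr hupp
    · obtain ⟨i, hi, rfl⟩ := hext u hu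
      rw [← hq i hi] at hut
      rcases hend i hi hut with rfl | rfl <;> rcases hend j hj rfl with rfl | rfl
      · rfl
      · exact absurd hut hlt.ne
      · exact absurd hut hlt.ne'
      · rfl
  rw [maxFace_of_subsingleton hsub, maxFace_of_subsingleton hsub]
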